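/- Let $k\ge 0$ be an integer, $a>0$, $c\in\mathbb R$, and write points of $\mathbb R^{k+1}$ as $x=(r,y)$ with $r\in\mathbb R$, $y\in\mathbb R^k$. Let $\Omega^\star\subset\mathbb R^{k+1}$ be a bounded, connected, non-empty open set, symmetric under $(r,y)\mapsto(-r,y)$ (no regularity of its boundary is assumed), and put $\Omega=\Omega^\star\cap\{r>0\}$ and $\Sigma=\partial\Omega^\star\cap\{r>0\}$. Let $$L_a u=\partial_{rr}u+\frac ar\,\partial_r u+\Delta_y u,\qquad \Gamma(u,v)=\tfrac12\bigl[L_a(uv)-u\,L_a v-v\,L_a u\bigr],\qquad P_a=\Gamma(u,u)+\frac{2}{a+1+k}\,u .$$ Suppose that $u\in C^2(\Omega)\cap C^1(\overline\Omega)$, that is, $u\in C^2(\Omega)$ and $u$ and $\nabla u$ extend continuously to $\overline\Omega$, and that $$L_a u=-1\ \text{ in }\Omega,\qquad u=0\ \text{ and }\ |\nabla u|=c\ \text{ on }\Sigma .$$ Then $(P_a-c^2)\,r^a$ is integrable over $\Omega$ and $$\int_\Omega\bigl(P_a(x)-c^2\bigr)\,r^a\,dx=0 .$$ -/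

import Mathlib

open MeasureTheory

noncomputable section

namespace Weinstein

/-- The Euclidean space `ℝ^{k+1} = ℝ_r × ℝ^k_y`. The coordinate with index `0` is `r`, the
coordinates with the indices `j.succ`, `j : Fin k`, are those of `y`. -/
abbrev Point (k : ℕ) : Type := EuclideanSpace ℝ (Fin (k + 1))

/-- The reflection `(r, y) ↦ (-r, y)` in the hyperplane `r = 0`. -/
def reflect {k : ℕ} (x : Point k) : Point k :=
  WithLp.toLp 2 (Fin.cons (-x 0) fun j : Fin k => x j.succ)

/-- The part of a set in the open half-space `r > 0`. -/
def halfDomain {k : ℕ} (D : Set (Point k)) : Set (Point k) := D ∩ {x | 0 < x 0}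

/-- The curved boundary part: the part of the boundary of `D` in the open half-space `r > 0`. -/
def curvedBoundary {k : ℕ} (D : Set (Point k)) : Set (Point k) := frontier D ∩ {x | 0 < x 0}

/-- The partial derivative of `u` in the `i`-th coordinate direction. -/
def partialDeriv {k : ℕ} (i : Fin (k + 1)) (u : Point k → ℝ) (x : Point k) : ℝ :=
  fderiv ℝ u x (EuclideanSpace.single i 1)

/-- The Weinstein operator `L_a u = ∂_rr u + (a / r) ∂_r u + Δ_y u`, used at points with `r > 0`. -/
def weinsteinOp {k : ℕ} (a : ℝ) (u : Point k → ℝ) (x : Point k) : ℝ :=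
  partialDeriv 0 (partialDeriv 0 u) x + a / x 0 * partialDeriv 0 u x
    + ∑ j : Fin k, partialDeriv j.succ (partialDeriv j.succ u) x

/-- The carré du champ `Γ^L(u, v) = (L(uv) - u Lv - v Lu) / 2` of an operator `L` on functions. -/
def carreDuChamp {k : ℕ} (L : (Point k → ℝ) → Point k → ℝ) (u v : Point k → ℝ) (x : Point k) : ℝ :=
  (L (fun z => u z * v z) x - u x * L v x - v x * L u x) / 2

/-- The function `P_a = Γ^{L_a}(u, u) + 2 u / (a + 1 + k)`. -/
def pFunction {k : ℕ} (a : ℝ) (u : Point k → ℝ) (x : Point k) : ℝ :=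
  carreDuChamp (weinsteinOp a) u u x + 2 / (a + 1 + k) * u x

/-- `u ∈ C^1(closure Ω)` for an open set `Ω`, with `G` the continuous extension of the gradient of
`u` from `Ω` to `closure Ω` (on `closure Ω` there is at most one such `G`). Nothing is said about
`u` and `G` outside of `closure Ω`. -/
structure IsC1UpToBoundary {k : ℕ} (Ω : Set (Point k)) (u : Point k → ℝ) (G : Point k → Point k) :
    Prop where
  contDiffOn : ContDiffOn ℝ 1 u Ω
  continuousOn : ContinuousOn u (closure Ω)
  continuousOn_grad : ContinuousOn G (closure Ω)
  grad_eq : ∀ x ∈ Ω, G x = gradient u x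

end Weinstein

end

/-!
The proof is a Pohozaev argument in the effective dimension `N = a + 1 + k`, the degree of
homogeneity of `r^a dx`. The field
`Z = (x · ∇u - (1 - N) u) ∇u + (u - |∇u|² / 2 - c² / 2) x` satisfies
`r^{-a} div (r^a Z) = (N / 2) (P_a - c²)` wherever `L_a u = -1` (`weightedDiv_pohozaevField`), and on
the curved boundary, where `u = 0` and `|∇u| = c`, it is tangential to the level sets of `u`:
`Z · ∇u = (x · ∇u) (|∇u|² - c²) / 2 + u (⋯)`.

Since the boundary may be irregular, the divergence theorem is applied to `η_ε(u) χ_δ(r) r^a Z`,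
with cutoffs `η_ε` and `χ_δ` that vanish on `(-∞, ε]` and `(-∞, δ]`; this field has compact support
in `Ω`. The error at `r = 0` is `O(δ^a)`, hence disappears as `δ → 0`
(`integral_weightedDiv_comp`). What remains is `∫ η_ε'(u) (Z · ∇u) r^a`. Testing the equation itself
with `η_ε(u)` bounds `∫ η_ε'(u) |∇u|² r^a` uniformly in `ε` (`integral_deriv_cutoff_gradSq_le`), and
where `u` is small `|(x · ∇u) (|∇u|² - c²)|` is at most a small multiple of `|∇u|²`
(`exists_flux_le`, with separate arguments for `c = 0` and `c ≠ 0`), so the remainder tends to `0`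
as `ε → 0`.

This uses that `u` is positive on the closure of `Ω` off the closure of the curved boundary, the
points with `r = 0` included (`pos_of_weinsteinOp_eq`): a weak maximum principle
(`nonneg_of_weinsteinOp_le`), itself proved by testing with a cutoff of `-u`, gives `u ≥ 0`, and a
comparison with `ρ² - |x - p|²` on a small ball around `p` gives `u p > 0`.
-/

namespace Weinstein

open Set Filter Topology

/-! ### Partial derivatives -/

section PartialDeriv

variable {k : ℕ} {i j : Fin (k + 1)} {f g : Point k → ℝ} {x : Point k}

lemma partialDeriv_mul (hf : DifferentiableAt ℝ f x) (hg : DifferentiableAt ℝ g x) :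
    partialDeriv i (fun z => f z * g z) x
      = partialDeriv i f x * g x + f x * partialDeriv i g x := by
  simp only [partialDeriv, fderiv_fun_mul hf hg, add_apply, smul_apply, smul_eq_mul]
  ring

lemma partialDeriv_add (hf : DifferentiableAt ℝ f x) (hg : DifferentiableAt ℝ g x) :
    partialDeriv i (fun z => f z + g z) x = partialDeriv i f x + partialDeriv i g x := by
  simp [partialDeriv, fderiv_fun_add hf hg]

lemma partialDeriv_sub (hf : DifferentiableAt ℝ f x) (hg : DifferentiableAt ℝ g x) :
    partialDeriv i (fun z => f z - g z) x = partialDeriv i f x - partialDeriv i g x := by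
  simp [partialDeriv, fderiv_fun_sub hf hg]

lemma partialDeriv_neg : partialDeriv i (fun z => -f z) x = -partialDeriv i f x := by
  simp [partialDeriv, fderiv_fun_neg]

lemma partialDeriv_const (b : ℝ) : partialDeriv i (fun _ : Point k => b) x = 0 := by
  simp [partialDeriv]

lemma partialDeriv_const_mul (b : ℝ) (hf : DifferentiableAt ℝ f x) :
    partialDeriv i (fun z => b * f z) x = b * partialDeriv i f x := by
  simp [partialDeriv, fderiv_const_mul hf]

lemma partialDeriv_sum {ι : Type*} {s : Finset ι} {F : ι → Point k → ℝ}
    (hF : ∀ l ∈ s, DifferentiableAt ℝ (F l) x) :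
    partialDeriv i (fun z => ∑ l ∈ s, F l z) x = ∑ l ∈ s, partialDeriv i (F l) x := by
  simp [partialDeriv, fderiv_fun_sum hF]

lemma differentiable_coord (j : Fin (k + 1)) : Differentiable ℝ (fun z : Point k => z j) := by
  fun_prop

lemma partialDeriv_coord : partialDeriv i (fun z : Point k => z j) x = if j = i then 1 else 0 := by
  have h : HasFDerivAt (fun z : Point k => z j) (EuclideanSpace.proj (𝕜 := ℝ) j) x :=
    (EuclideanSpace.proj j : Point k →L[ℝ] ℝ).hasFDerivAt
  simp [partialDeriv, h.fderiv]

lemma partialDeriv_comp {φ : ℝ → ℝ} (hφ : DifferentiableAt ℝ φ (f x))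
    (hf : DifferentiableAt ℝ f x) :
    partialDeriv i (fun z => φ (f z)) x = deriv φ (f x) * partialDeriv i f x := by
  have h : HasFDerivAt (fun z => φ (f z)) (deriv φ (f x) • fderiv ℝ f x) x :=
    hφ.hasDerivAt.comp_hasFDerivAt x hf.hasFDerivAt
  simp [partialDeriv, h.fderiv]

lemma partialDeriv_congr (h : f =ᶠ[𝓝 x] g) : partialDeriv i f x = partialDeriv i g x := by
  simp [partialDeriv, h.fderiv_eq]

lemma contDiffOn_partialDeriv {D : Set (Point k)} (hD : IsOpen D) {n : ℕ}
    (hf : ContDiffOn ℝ (n + 1) f D) : ContDiffOn ℝ n (partialDeriv i f) D :=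
  ((hf.fderiv_of_isOpen hD le_rfl).clm_apply contDiffOn_const)

/-- Mixed partial derivatives of a `C²` function commute. -/
lemma partialDeriv_comm {D : Set (Point k)} (hD : IsOpen D) (hf : ContDiffOn ℝ 2 f D)
    (hx : x ∈ D) :
    partialDeriv i (partialDeriv j f) x = partialDeriv j (partialDeriv i f) x := by
  have hd : DifferentiableAt ℝ (fderiv ℝ f) x :=
    ((hf.fderiv_of_isOpen hD (m := 1) (by norm_num)).differentiableOn (by norm_num)).differentiableAt
      (hD.mem_nhds hx)
  have key : ∀ l m : Fin (k + 1), partialDeriv l (partialDeriv m f) x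
      = fderiv ℝ (fderiv ℝ f) x (EuclideanSpace.single l 1) (EuclideanSpace.single m 1) := by
    intro l m
    have := hd.hasFDerivAt.clm_apply
      (hasFDerivAt_const (EuclideanSpace.single m (1 : ℝ) : Point k) x)
    change fderiv ℝ (fun z => fderiv ℝ f z (EuclideanSpace.single m 1)) x _ = _
    rw [this.fderiv]
    simp
  rw [key, key]
  exact ((hf.contDiffAt (hD.mem_nhds hx)).isSymmSndFDerivAt (by simp)).eq _ _

lemma gradient_apply : gradient f x i = partialDeriv i f x := by
  have h : inner ℝ (gradient f x) (EuclideanSpace.single i (1 : ℝ)) = partialDeriv i f x := by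
    simp [gradient, partialDeriv]
  rw [← h, EuclideanSpace.inner_single_right]
  simp only [one_mul, conj_trivial]

end PartialDeriv

/-! ### The divergence theorem for compactly supported fields -/

section Divergence

variable {k : ℕ} {i : Fin (k + 1)} {f : Point k → ℝ} {D K : Set (Point k)}

/-- The integral of a partial derivative of a function with compact support in an open set `D`
vanishes. The function need only be `C¹` on `D`. -/
lemma integral_partialDeriv_eq_zero (hD : IsOpen D) (hK : IsCompact K) (hKD : K ⊆ D)
    (hf : ContDiffOn ℝ 1 f D) (hf0 : ∀ x ∈ D, x ∉ K → f x = 0) :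
    IntegrableOn (partialDeriv i f) D ∧ ∫ x in D, partialDeriv i f x = 0 := by
  classical
  set F : Point k → ℝ := D.indicator f with hF
  have hin : ∀ x ∈ D, F =ᶠ[𝓝 x] f := fun x hx => by
    filter_upwards [hD.mem_nhds hx] with y hy using indicator_of_mem hy f
  have hzero : ∀ x, x ∉ K → F x = 0 := fun x hx => by
    by_cases hxD : x ∈ D
    · rw [hF, indicator_of_mem hxD]; exact hf0 x hxD hx
    · exact indicator_of_notMem hxD f
  have hout : ∀ x, x ∉ K → F =ᶠ[𝓝 x] fun _ => 0 := fun x hx => by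
    filter_upwards [hK.isClosed.isOpen_compl.mem_nhds hx] with y hy using hzero y hy
  have hFC : ContDiff ℝ 1 F := contDiff_iff_contDiffAt.2 fun x => by
    by_cases hx : x ∈ K
    · exact (hf.contDiffAt (hD.mem_nhds (hKD hx))).congr_of_eventuallyEq (hin x (hKD hx))
    · exact contDiffAt_const.congr_of_eventuallyEq (hout x hx)
  have hFsupp : HasCompactSupport F := HasCompactSupport.intro hK hzero
  have hdc : Continuous (partialDeriv i F) :=
    (hFC.continuous_fderiv (by norm_num)).clm_apply continuous_const
  have hdsupp : HasCompactSupport (partialDeriv i F) := HasCompactSupport.intro hK fun x hx => by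
    rw [partialDeriv_congr (hout x hx), partialDeriv_const]
  have hint : Integrable (partialDeriv i F) := hdc.integrable_of_hasCompactSupport hdsupp
  have h0 : ∫ x, partialDeriv i F x = 0 := by
    have := integral_mul_fderiv_eq_neg_fderiv_mul_of_integrable (𝕜 := ℝ)
      (μ := (volume : Measure (Point k)))
      (f := fun _ => (1 : ℝ)) (g := F) (v := EuclideanSpace.single i 1) (by simp)
      (by simp only [one_mul]; exact hint)
      (by simpa using hFC.continuous.integrable_of_hasCompactSupport hFsupp)
      (fun _ _ => by fun_prop) (fun x _ => (hFC.differentiable (by norm_num)) x)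
    simpa [partialDeriv] using this
  have heq : EqOn (partialDeriv i F) (partialDeriv i f) D := fun x hx => partialDeriv_congr (hin x hx)
  refine ⟨hint.integrableOn.congr_fun heq hD.measurableSet, ?_⟩
  rw [← setIntegral_congr_fun hD.measurableSet heq, setIntegral_eq_integral_of_forall_compl_eq_zero,
    h0]
  intro x hx
  rw [partialDeriv_congr (hout x fun h => hx (hKD h)), partialDeriv_const]

lemma integrableOn_of_continuousOn_of_bounded {h : Point k → ℝ} {C : ℝ} (hD : IsOpen D)
    (hb : Bornology.IsBounded D) (hc : ContinuousOn h D) (hC : ∀ x ∈ D, |h x| ≤ C) :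
    IntegrableOn h D :=
  have : IsFiniteMeasure (volume.restrict D) := ⟨by simpa using hb.measure_lt_top⟩
  Integrable.of_bound (hc.aestronglyMeasurable hD.measurableSet) C
    (by filter_upwards [ae_restrict_mem hD.measurableSet] with x hx using hC x hx)

/-- The part of a bounded set in a slab `0 ≤ r ≤ t` has volume `O(t)`. -/
lemma exists_measureReal_slab_le (hb : Bornology.IsBounded D) :
    ∃ C : ℝ, ∀ t : ℝ, 0 ≤ t → volume.real (D ∩ {x | 0 ≤ x 0 ∧ x 0 ≤ t}) ≤ C * t := by
  obtain ⟨R, hR0, hR⟩ := hb.exists_pos_norm_le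
  refine ⟨(2 * R) ^ k, fun t ht => ?_⟩
  set lo : Fin (k + 1) → ℝ := Fin.cons 0 fun _ => -R
  set hi : Fin (k + 1) → ℝ := Fin.cons t fun _ => R
  have hle : lo ≤ hi := by
    intro j
    refine Fin.cases ?_ (fun l => ?_) j
    · simpa [lo, hi] using ht
    · simp only [lo, hi, Fin.cons_succ]; linarith
  have hsub : D ∩ {x | 0 ≤ x 0 ∧ x 0 ≤ t} ⊆ WithLp.ofLp ⁻¹' (Icc lo hi) := by
    rintro x ⟨hxD, hx0, hxt⟩
    have hn : ∀ j, |x j| ≤ R := fun j => (PiLp.norm_apply_le x j).trans (hR x hxD)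
    constructor <;> intro j <;> refine Fin.cases ?_ (fun l => ?_) j
    · simpa [lo] using hx0
    · simpa [lo] using (abs_le.1 (hn l.succ)).1
    · simpa [hi] using hxt
    · simpa [hi] using (abs_le.1 (hn l.succ)).2
  have hv : (volume : Measure (Point k)) (WithLp.ofLp ⁻¹' (Icc lo hi)) = volume (Icc lo hi) :=
    (PiLp.volume_preserving_ofLp (Fin (k + 1))).measure_preimage measurableSet_Icc.nullMeasurableSet
  have hfin : (volume : Measure (Point k)) (WithLp.ofLp ⁻¹' (Icc lo hi)) ≠ ⊤ := by
    rw [hv]; exact isCompact_Icc.measure_lt_top.ne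
  refine (measureReal_mono hsub hfin).trans (le_of_eq ?_)
  rw [measureReal_def, hv, Real.volume_Icc_pi_toReal hle, Fin.prod_univ_succ]
  simp [lo, hi]
  ring

end Divergence

/-! ### Cutoff functions -/

section Cutoff

lemma exists_abs_deriv_smoothTransition_le :
    ∃ M, 0 ≤ M ∧ ∀ t, |deriv Real.smoothTransition t| ≤ M := by
  have hc : Continuous (deriv Real.smoothTransition) :=
    Real.smoothTransition.contDiff.continuous_deriv (n := 1) le_rfl
  obtain ⟨M, hM⟩ := isCompact_Icc.exists_bound_of_continuousOn (s := Icc (0 : ℝ) 1) hc.continuousOn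
  refine ⟨max M 0, le_max_right _ _, fun t => ?_⟩
  by_cases ht : t ∈ Icc (0 : ℝ) 1
  · exact (hM t ht).trans (le_max_left _ _)
  have h0 : deriv Real.smoothTransition t = 0 := by
    rw [mem_Icc, not_and_or, not_le, not_le] at ht
    rcases ht with ht | ht
    · have : Real.smoothTransition =ᶠ[𝓝 t] fun _ => 0 := by
        filter_upwards [Iio_mem_nhds ht] with s hs
          using Real.smoothTransition.zero_of_nonpos (le_of_lt hs)
      simpa using this.deriv_eq
    · have : Real.smoothTransition =ᶠ[𝓝 t] fun _ => 1 := by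
        filter_upwards [Ioi_mem_nhds ht] with s hs
          using Real.smoothTransition.one_of_one_le (le_of_lt hs)
      simpa using this.deriv_eq
  simp [h0]

/-- The smooth cutoff equal to `0` on `t ≤ ε` and to `1` on `t ≥ 2 ε`. -/
noncomputable def cutoff (ε t : ℝ) : ℝ := Real.smoothTransition (t / ε - 1)

variable {ε t : ℝ}

lemma contDiff_cutoff : ContDiff ℝ 1 (cutoff ε) := by
  unfold cutoff
  exact Real.smoothTransition.contDiff.comp ((contDiff_id.div_const ε).sub contDiff_const)

lemma cutoff_eq_zero (hε : 0 < ε) (ht : t ≤ ε) : cutoff ε t = 0 :=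
  Real.smoothTransition.zero_of_nonpos (by rw [sub_nonpos, div_le_one hε]; exact ht)

lemma cutoff_pos (hε : 0 < ε) (ht : ε < t) : 0 < cutoff ε t :=
  Real.smoothTransition.pos_of_pos (by rw [sub_pos, one_lt_div hε]; exact ht)

lemma cutoff_eq_one (hε : 0 < ε) (ht : 2 * ε ≤ t) : cutoff ε t = 1 :=
  Real.smoothTransition.one_of_one_le (by rw [le_sub_iff_add_le, le_div_iff₀ hε]; linarith)

lemma cutoff_nonneg : 0 ≤ cutoff ε t := Real.smoothTransition.nonneg _

lemma cutoff_le_one : cutoff ε t ≤ 1 := Real.smoothTransition.le_one _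

lemma abs_cutoff_le_one : |cutoff ε t| ≤ 1 := by
  rw [abs_of_nonneg cutoff_nonneg]; exact cutoff_le_one

lemma deriv_cutoff_nonneg (hε : 0 < ε) : 0 ≤ deriv (cutoff ε) t := by
  have : Monotone (cutoff ε) := fun s t h => Real.smoothTransition.monotone (by gcongr)
  exact this.deriv_nonneg

lemma deriv_cutoff_of_gt (hε : 0 < ε) (ht : 2 * ε < t) : deriv (cutoff ε) t = 0 := by
  have : cutoff ε =ᶠ[𝓝 t] fun _ => 1 := by
    filter_upwards [Ioi_mem_nhds ht] with s hs using cutoff_eq_one hε (le_of_lt hs)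
  simpa using this.deriv_eq

lemma exists_abs_deriv_cutoff_le : ∃ M, 0 ≤ M ∧ ∀ ε t, 0 < ε → |deriv (cutoff ε) t| ≤ M / ε := by
  obtain ⟨M, hM0, hM⟩ := exists_abs_deriv_smoothTransition_le
  refine ⟨M, hM0, fun ε t hε => ?_⟩
  have h1 : HasDerivAt (fun s : ℝ => s / ε - 1) (1 / ε) t :=
    ((hasDerivAt_id t).div_const ε).sub_const 1
  have h2 := ((Real.smoothTransition.contDiff (n := 1)).differentiable
    (by norm_num) (t / ε - 1)).hasDerivAt.comp t h1
  have h3 : deriv (cutoff ε) t = deriv Real.smoothTransition (t / ε - 1) * (1 / ε) := h2.deriv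
  rw [h3, abs_mul, abs_of_pos (one_div_pos.2 hε), mul_one_div]
  gcongr
  exact hM _

end Cutoff

/-! ### Bounded continuous functions on a set -/

/-- `f` is continuous and bounded on `D`. -/
def BddCont {k : ℕ} (D : Set (Point k)) (f : Point k → ℝ) : Prop :=
  ContinuousOn f D ∧ ∃ C, ∀ x ∈ D, |f x| ≤ C

namespace BddCont

variable {k : ℕ} {D : Set (Point k)} {f g : Point k → ℝ}

lemma congr (hf : BddCont D f) (h : ∀ x ∈ D, g x = f x) : BddCont D g :=
  ⟨hf.1.congr h, hf.2.imp fun _ hC x hx => by rw [h x hx]; exact hC x hx⟩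

lemma const (b : ℝ) : BddCont D fun _ => b := ⟨continuousOn_const, |b|, fun _ _ => le_rfl⟩

lemma add (hf : BddCont D f) (hg : BddCont D g) : BddCont D fun x => f x + g x := by
  obtain ⟨hfc, A, hA⟩ := hf
  obtain ⟨hgc, B, hB⟩ := hg
  exact ⟨hfc.add hgc, A + B, fun x hx => (abs_add_le _ _).trans (add_le_add (hA x hx) (hB x hx))⟩

lemma mul (hf : BddCont D f) (hg : BddCont D g) : BddCont D fun x => f x * g x := by
  obtain ⟨hfc, A, hA⟩ := hf
  obtain ⟨hgc, B, hB⟩ := hg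
  refine ⟨hfc.mul hgc, A * B, fun x hx => ?_⟩
  rw [abs_mul]
  exact mul_le_mul (hA x hx) (hB x hx) (abs_nonneg _) ((abs_nonneg _).trans (hA x hx))

lemma neg (hf : BddCont D f) : BddCont D fun x => -f x :=
  ⟨hf.1.neg, hf.2.imp fun _ hC x hx => by rw [abs_neg]; exact hC x hx⟩

lemma sub (hf : BddCont D f) (hg : BddCont D g) : BddCont D fun x => f x - g x :=
  (hf.add hg.neg).congr fun _ _ => sub_eq_add_neg _ _

lemma sum {ι : Type*} {s : Finset ι} {F : ι → Point k → ℝ} (hF : ∀ i ∈ s, BddCont D (F i)) :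
    BddCont D fun x => ∑ i ∈ s, F i x := by
  classical
  induction s using Finset.induction_on with
  | empty => exact (const 0).congr fun x _ => by simp
  | insert i s his ih =>
    refine ((hF i (Finset.mem_insert_self _ _)).add
      (ih fun l hl => hF l (Finset.mem_insert_of_mem hl))).congr fun x _ => ?_
    exact Finset.sum_insert his

lemma of_continuousOn_closure (hb : Bornology.IsBounded D) (hf : ContinuousOn f (closure D)) :
    BddCont D f := by
  obtain ⟨C, hC⟩ := hb.isCompact_closure.exists_bound_of_continuousOn hf
  exact ⟨hf.mono subset_closure, C, fun x hx => hC x (subset_closure hx)⟩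

lemma coord (hb : Bornology.IsBounded D) (j : Fin (k + 1)) : BddCont D fun x => x j :=
  of_continuousOn_closure hb (by fun_prop)

lemma weight {a : ℝ} (ha : 0 < a) (hb : Bornology.IsBounded D) : BddCont D fun x => x 0 ^ a :=
  of_continuousOn_closure hb
    (ContinuousOn.rpow_const (by fun_prop) fun _ _ => Or.inr ha.le)

lemma integrableOn (hf : BddCont D f) (hD : IsOpen D) (hb : Bornology.IsBounded D) :
    IntegrableOn f D :=
  let ⟨_, hC⟩ := hf.2
  integrableOn_of_continuousOn_of_bounded hD hb hf.1 hC

end BddCont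

/-! ### Integration by parts against a function of `w` -/

/-- The weighted divergence `r^{-a} div (r^a Z) = div Z + (a / r) Z_r` of the field with the
components `Z i`. -/
noncomputable def weightedDiv {k : ℕ} (a : ℝ) (Z : Fin (k + 1) → Point k → ℝ) (x : Point k) : ℝ :=
  ∑ i, partialDeriv i (Z i) x + a / x 0 * Z 0 x

section IntegrationByParts

variable {k : ℕ} {a ε δ : ℝ} {D : Set (Point k)} {w : Point k → ℝ} {g : ℝ → ℝ}
  {Z : Fin (k + 1) → Point k → ℝ}

lemma partialDeriv_cutoff_field (hD : IsOpen D) (hpos : ∀ x ∈ D, 0 < x 0)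
    (hw : ContDiffOn ℝ 1 w D) (hg : ContDiff ℝ 1 g) (hZ : ∀ i, ContDiffOn ℝ 1 (Z i) D)
    {x : Point k} (hx : x ∈ D) (i : Fin (k + 1)) :
    partialDeriv i (fun z => cutoff δ (z 0) * z 0 ^ a * (g (w z) * Z i z)) x
      = (if (0 : Fin (k + 1)) = i then
          (deriv (cutoff δ) (x 0) + cutoff δ (x 0) * (a / x 0)) * x 0 ^ a * (g (w x) * Z i x)
          else 0)
        + cutoff δ (x 0) * x 0 ^ a
          * (deriv g (w x) * (Z i x * partialDeriv i w x) + g (w x) * partialDeriv i (Z i) x) := by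
  have hx0 := hpos x hx
  have hdw : DifferentiableAt ℝ w x := (hw.differentiableOn (by norm_num)).differentiableAt
    (hD.mem_nhds hx)
  have hdZ : DifferentiableAt ℝ (Z i) x :=
    ((hZ i).differentiableOn (by norm_num)).differentiableAt (hD.mem_nhds hx)
  have hdg : DifferentiableAt ℝ g (w x) := hg.differentiable (by norm_num) _
  have hdc : DifferentiableAt ℝ (cutoff δ) (x 0) := contDiff_cutoff.differentiable (by norm_num) _
  have hφ : HasDerivAt (fun r : ℝ => cutoff δ r * r ^ a)
      (deriv (cutoff δ) (x 0) * x 0 ^ a + cutoff δ (x 0) * (a * x 0 ^ (a - 1))) (x 0) :=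
    hdc.hasDerivAt.mul (Real.hasDerivAt_rpow_const (Or.inl hx0.ne'))
  have hc0 := differentiable_coord (k := k) 0 x
  have hφd : DifferentiableAt ℝ (fun z : Point k => cutoff δ (z 0) * z 0 ^ a) x :=
    DifferentiableAt.comp (g := fun r : ℝ => cutoff δ r * r ^ a) x hφ.differentiableAt hc0
  have hgw : DifferentiableAt ℝ (fun z => g (w z)) x := DifferentiableAt.comp x hdg hdw
  have hgZ : DifferentiableAt ℝ (fun z => g (w z) * Z i z) x := hgw.mul hdZ
  have hφp : partialDeriv i (fun z : Point k => cutoff δ (z 0) * z 0 ^ a) x = _ :=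
    partialDeriv_comp (φ := fun r : ℝ => cutoff δ r * r ^ a) hφ.differentiableAt hc0
  rw [partialDeriv_mul hφd hgZ, partialDeriv_mul hgw hdZ, partialDeriv_comp hdg hdw, hφp,
    partialDeriv_coord, hφ.deriv, Real.rpow_sub_one hx0.ne']
  split_ifs <;> field_simp
  ring

/-- The divergence theorem for `χ(r) g(w) r^a Z`, where `χ` vanishes near `r = 0` and `g(w)`
vanishes near the part of the boundary in `r > 0`. -/
lemma integral_cutoff_weightedDiv (hδ : 0 < δ) (hε : 0 < ε) (hD : IsOpen D)
    (hb : Bornology.IsBounded D) (hpos : ∀ x ∈ D, 0 < x 0)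
    (hwc : ContinuousOn w (closure D)) (hw : ContDiffOn ℝ 1 w D)
    (hbdry : ∀ x ∈ frontier D, 0 < x 0 → w x ≤ 0)
    (hg : ContDiff ℝ 1 g) (hg0 : ∀ t ≤ ε, g t = 0) (hZ : ∀ i, ContDiffOn ℝ 1 (Z i) D) :
    ∫ x in D, (cutoff δ (x 0) * ((g (w x) * weightedDiv a Z x
        + deriv g (w x) * ∑ i, Z i x * partialDeriv i w x) * x 0 ^ a)
      + deriv (cutoff δ) (x 0) * (g (w x) * Z 0 x * x 0 ^ a)) = 0 := by
  set K : Set (Point k) := {x | x ∈ closure D ∧ ε ≤ w x} ∩ {x | δ ≤ x 0} with hK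
  have hKc : IsCompact K := by
    have h1 : IsClosed {x | x ∈ closure D ∧ ε ≤ w x} :=
      hwc.preimage_isClosed_of_isClosed isClosed_closure isClosed_Ici
    exact hb.isCompact_closure.of_isClosed_subset
      (h1.inter (isClosed_le continuous_const (by fun_prop))) fun x hx => hx.1.1
  have hKD : K ⊆ D := fun x hx => by
    by_contra hxD
    have := hbdry x (by rw [hD.frontier_eq]; exact ⟨hx.1.1, hxD⟩) (hδ.trans_le hx.2)
    linarith [hx.1.2]
  have hf0 : ∀ i, ∀ x ∈ D, x ∉ K → cutoff δ (x 0) * x 0 ^ a * (g (w x) * Z i x) = 0 := by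
    intro i x hx hxK
    rcases le_or_gt (w x) ε with h | h
    · rw [hg0 _ h]; ring
    · rw [cutoff_eq_zero hδ]; · ring
      by_contra! h'
      exact hxK ⟨⟨subset_closure hx, h.le⟩, h'.le⟩
  have hfC : ∀ i, ContDiffOn ℝ 1 (fun x => cutoff δ (x 0) * x 0 ^ a * (g (w x) * Z i x)) D := by
    intro i
    have hc : ContDiffOn ℝ 1 (fun x : Point k => x 0) D := by fun_prop
    exact ((contDiff_cutoff.comp_contDiffOn hc).mul
      (hc.rpow_const_of_ne fun x hx => (hpos x hx).ne')).mul
        ((hg.comp_contDiffOn hw).mul (hZ i))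
  have key := fun i => integral_partialDeriv_eq_zero (i := i) hD hKc hKD (hfC i) (hf0 i)
  have hsum : ∫ x in D, ∑ i, partialDeriv i
      (fun x => cutoff δ (x 0) * x 0 ^ a * (g (w x) * Z i x)) x = 0 := by
    rw [integral_finsetSum _ fun i _ => (key i).1]
    exact Finset.sum_eq_zero fun i _ => (key i).2
  rw [← hsum]
  refine setIntegral_congr_fun hD.measurableSet fun x hx => ?_
  simp only
  rw [Finset.sum_congr rfl fun i _ => partialDeriv_cutoff_field hD hpos hw hg hZ hx i,
    Finset.sum_add_distrib, Finset.sum_ite_eq, ← Finset.mul_sum, Finset.sum_add_distrib,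
    ← Finset.mul_sum, ← Finset.mul_sum]
  simp only [Finset.mem_univ, if_true, weightedDiv]
  ring

lemma tendsto_integral_deriv_cutoff (ha : 0 < a) (hD : IsOpen D)
    (hb : Bornology.IsBounded D) (hpos : ∀ x ∈ D, 0 < x 0) {h : Point k → ℝ} (hh : BddCont D h) :
    Tendsto (fun n : ℕ => ∫ x in D, deriv (cutoff (1 / ((n : ℝ) + 1))) (x 0) * (h x * x 0 ^ a))
      atTop (𝓝 0) := by
  obtain ⟨M, hM0, hM⟩ := exists_abs_deriv_cutoff_le
  obtain ⟨V, hV⟩ := exists_measureReal_slab_le hb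
  obtain ⟨C, hC⟩ := hh.2
  have hlim : Tendsto (fun n : ℕ => 2 * M * max C 0 * V * (2 * (1 / ((n : ℝ) + 1))) ^ a)
      atTop (𝓝 0) := by
    have h1 := (tendsto_one_div_add_atTop_nhds_zero_nat (𝕜 := ℝ)).const_mul 2
    have h2 := (h1.rpow_const (p := a) (Or.inr ha.le)).const_mul (2 * M * max C 0 * V)
    simpa [Real.zero_rpow ha.ne'] using h2
  refine squeeze_zero_norm (fun n => ?_) hlim
  set δ : ℝ := 1 / ((n : ℝ) + 1) with hδdef
  have hδ : 0 < δ := by positivity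
  set S : Set (Point k) := D ∩ {x | 0 ≤ x 0 ∧ x 0 ≤ 2 * δ} with hS
  have hSfin : volume S < ⊤ := (hb.subset inter_subset_left).measure_lt_top
  have hzero : ∀ x ∈ D \ S, deriv (cutoff δ) (x 0) * (h x * x 0 ^ a) = 0 := by
    rintro x ⟨hxD, hxS⟩
    have : 2 * δ < x 0 := by
      by_contra! h
      exact hxS ⟨hxD, (hpos x hxD).le, h⟩
    rw [deriv_cutoff_of_gt hδ this, zero_mul]
  rw [setIntegral_eq_of_subset_of_forall_sdiff_eq_zero hD.measurableSet inter_subset_left hzero]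
  · refine (norm_setIntegral_le_of_norm_le_const
      (C := M / δ * (max C 0 * (2 * δ) ^ a)) hSfin fun x hx => ?_).trans ?_
    · have hx0 := hpos x hx.1
      rw [norm_mul, norm_mul]
      simp only [Real.norm_eq_abs]
      rw [abs_of_nonneg (Real.rpow_nonneg hx0.le a)]
      have h1 := hM δ (x 0) hδ
      have h2 : |h x| ≤ max C 0 := (hC x hx.1).trans (le_max_left _ _)
      have h3 : x 0 ^ a ≤ (2 * δ) ^ a := Real.rpow_le_rpow hx0.le hx.2.2 ha.le
      gcongr
    · calc M / δ * (max C 0 * (2 * δ) ^ a) * volume.real S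
          ≤ M / δ * (max C 0 * (2 * δ) ^ a) * (V * (2 * δ)) := by
            gcongr
            exact hV (2 * δ) (by positivity)
        _ = _ := by field_simp

/-- Weighted integration by parts on `D ⊆ {r > 0}` with the test function `g(w)`, where `w ≤ 0` on
the part of the boundary in `r > 0`. There is no boundary term at `r = 0`, because the flux of
`r^a Z` through `r = δ` is `O(δ^a)` and `a > 0`. No regularity of the boundary is needed, because
`g` vanishes on a neighbourhood of `(-∞, 0]`. -/
lemma integral_weightedDiv_comp (ha : 0 < a) (hε : 0 < ε) (hD : IsOpen D)
    (hb : Bornology.IsBounded D) (hpos : ∀ x ∈ D, 0 < x 0)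
    (hwc : ContinuousOn w (closure D)) (hw : ContDiffOn ℝ 1 w D)
    (hwb : ∀ i, BddCont D (partialDeriv i w))
    (hbdry : ∀ x ∈ frontier D, 0 < x 0 → w x ≤ 0)
    (hg : ContDiff ℝ 1 g) (hg0 : ∀ t ≤ ε, g t = 0) (hZ : ∀ i, ContDiffOn ℝ 1 (Z i) D)
    (hZb : ∀ i, BddCont D (Z i)) (hdiv : BddCont D (weightedDiv a Z)) :
    ∫ x in D, (g (w x) * weightedDiv a Z x
        + deriv g (w x) * ∑ i, Z i x * partialDeriv i w x) * x 0 ^ a = 0 := by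
  have hgw : BddCont D fun x => g (w x) :=
    BddCont.of_continuousOn_closure hb (hg.continuous.comp_continuousOn hwc)
  have hgw' : BddCont D fun x => deriv g (w x) :=
    BddCont.of_continuousOn_closure hb ((hg.continuous_deriv le_rfl).comp_continuousOn hwc)
  have hH : BddCont D fun x => (g (w x) * weightedDiv a Z x
        + deriv g (w x) * ∑ i, Z i x * partialDeriv i w x) * x 0 ^ a :=
    ((hgw.mul hdiv).add (hgw'.mul (BddCont.sum fun i _ => (hZb i).mul (hwb i)))).mul
      (BddCont.weight ha hb)
  set H := fun x => (g (w x) * weightedDiv a Z x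
        + deriv g (w x) * ∑ i, Z i x * partialDeriv i w x) * x 0 ^ a with hHdef
  have hδ : ∀ n : ℕ, (0 : ℝ) < 1 / ((n : ℝ) + 1) := fun n => by positivity
  have hcc : ∀ n : ℕ, BddCont D fun x => cutoff (1 / ((n : ℝ) + 1)) (x 0) := fun n =>
    BddCont.of_continuousOn_closure hb (contDiff_cutoff.continuous.comp_continuousOn (by fun_prop))
  have hcd : ∀ n : ℕ, BddCont D fun x => deriv (cutoff (1 / ((n : ℝ) + 1))) (x 0) := fun n =>
    BddCont.of_continuousOn_closure hb
      ((contDiff_cutoff.continuous_deriv le_rfl).comp_continuousOn (by fun_prop))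
  have heq : ∀ n : ℕ, ∫ x in D, cutoff (1 / ((n : ℝ) + 1)) (x 0) * H x
      = -∫ x in D, deriv (cutoff (1 / ((n : ℝ) + 1))) (x 0) * (g (w x) * Z 0 x * x 0 ^ a) := by
    intro n
    rw [eq_neg_iff_add_eq_zero, ← integral_add]
    · exact integral_cutoff_weightedDiv (hδ n) hε hD hb hpos hwc hw hbdry hg hg0 hZ
    · exact ((hcc n).mul hH).integrableOn hD hb
    · exact ((hcd n).mul ((hgw.mul (hZb 0)).mul (BddCont.weight ha hb))).integrableOn hD hb
  have hlim1 : Tendsto (fun n : ℕ => ∫ x in D, cutoff (1 / ((n : ℝ) + 1)) (x 0) * H x) atTop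
      (𝓝 (∫ x in D, H x)) := by
    refine tendsto_integral_of_dominated_convergence (fun x => |H x|)
      (fun n => (((hcc n).mul hH).integrableOn hD hb).aestronglyMeasurable)
      (hH.integrableOn hD hb).abs (fun n => ?_) ?_
    · refine Eventually.of_forall fun x => ?_
      rw [Real.norm_eq_abs, abs_mul]
      exact mul_le_of_le_one_left (abs_nonneg _) abs_cutoff_le_one
    · filter_upwards [ae_restrict_mem hD.measurableSet] with x hx
      have hx0 := hpos x hx
      refine tendsto_const_nhds.congr' ?_
      have h1 := (tendsto_one_div_add_atTop_nhds_zero_nat (𝕜 := ℝ)).const_mul 2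
      rw [mul_zero] at h1
      filter_upwards [h1.eventually (gt_mem_nhds hx0)] with n hn
      rw [cutoff_eq_one (hδ n) hn.le, one_mul]
  have hlim2 := (tendsto_integral_deriv_cutoff ha hD hb hpos (hgw.mul (hZb 0))).neg
  rw [neg_zero] at hlim2
  exact tendsto_nhds_unique hlim1 (hlim2.congr fun n => (heq n).symm)

end IntegrationByParts

/-! ### The maximum principle -/

section MaximumPrinciple

variable {k : ℕ} {a κ : ℝ} {D : Set (Point k)} {u v : Point k → ℝ}

lemma weinsteinOp_eq_weightedDiv (x : Point k) :
    weinsteinOp a u x = weightedDiv a (fun i => partialDeriv i u) x := by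
  simp only [weinsteinOp, weightedDiv, Fin.sum_univ_succ]
  ring

/-- The weak maximum principle for `L_a` with a boundary condition on the part of the boundary in
`r > 0` only: since `a > 0` and the gradient is bounded, none is needed at `r = 0`. -/
lemma nonneg_of_weinsteinOp_le (ha : 0 < a) (hD : IsOpen D) (hb : Bornology.IsBounded D)
    (hpos : ∀ x ∈ D, 0 < x 0) (hv : ContDiffOn ℝ 2 v D) (hvc : ContinuousOn v (closure D))
    (hvb : ∀ i, BddCont D (partialDeriv i v)) (hL : BddCont D (weinsteinOp a v))
    (hκ : 0 < κ) (hLκ : ∀ x ∈ D, weinsteinOp a v x ≤ -κ)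
    (hbdry : ∀ x ∈ frontier D, 0 < x 0 → 0 ≤ v x) : ∀ x ∈ D, 0 ≤ v x := by
  by_contra! hneg
  obtain ⟨p, hp, hvp⟩ := hneg
  set ε : ℝ := -v p / 2 with hεdef
  have hε : 0 < ε := by rw [hεdef]; linarith
  have hLd : BddCont D (weightedDiv a fun i => partialDeriv i v) :=
    hL.congr fun x _ => (weinsteinOp_eq_weightedDiv x).symm
  have hg : ContDiff ℝ 1 (cutoff ε) := contDiff_cutoff
  have hwb : ∀ i, BddCont D (partialDeriv i fun z => -v z) := fun i =>
    (hvb i).neg.congr fun x _ => partialDeriv_neg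
  have key := integral_weightedDiv_comp (w := fun z => -v z) ha hε hD hb hpos hvc.neg
    (hv.of_le (by norm_num)).neg hwb (fun x hx h => neg_nonpos.2 (hbdry x hx h)) hg
    (fun t ht => cutoff_eq_zero hε ht) (fun i => contDiffOn_partialDeriv hD (n := 1) hv) hvb hLd
  have hgw : BddCont D fun x => cutoff ε (-v x) :=
    BddCont.of_continuousOn_closure hb (hg.continuous.comp_continuousOn hvc.neg)
  have hgw' : BddCont D fun x => deriv (cutoff ε) (-v x) :=
    BddCont.of_continuousOn_closure hb ((hg.continuous_deriv le_rfl).comp_continuousOn hvc.neg)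
  have hint := (((hgw.mul hLd).add (hgw'.mul (BddCont.sum (s := Finset.univ)
    fun i _ => (hvb i).mul (hwb i)))).mul (BddCont.weight ha hb)).integrableOn hD hb
  have hlow := (hgw.mul (BddCont.weight ha hb))
  have hle : ∫ x in D, κ * (cutoff ε (-v x) * x 0 ^ a) ≤ ∫ x in D, -((cutoff ε (-v x)
      * weightedDiv a (fun i => partialDeriv i v) x + deriv (cutoff ε) (-v x)
      * ∑ i, partialDeriv i v x * partialDeriv i (fun z => -v z) x) * x 0 ^ a) := by
    refine setIntegral_mono_on ((hlow.integrableOn hD hb).const_mul κ) hint.neg hD.measurableSet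
      fun x hx => ?_
    have hr : 0 ≤ x 0 ^ a := Real.rpow_nonneg (hpos x hx).le a
    have h1 := hLκ x hx
    rw [weinsteinOp_eq_weightedDiv] at h1
    have h2 : ∑ i, partialDeriv i v x * partialDeriv i (fun z => -v z) x ≤ 0 :=
      Finset.sum_nonpos fun i _ => by
        rw [partialDeriv_neg]; nlinarith [mul_self_nonneg (partialDeriv i v x)]
    have h3 := mul_nonneg (cutoff_nonneg (ε := ε) (t := -v x)) (sub_nonneg.2 h1)
    have h4 := mul_nonneg (deriv_cutoff_nonneg (t := -v x) hε) (neg_nonneg.2 h2)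
    rw [← mul_assoc, ← neg_mul]
    refine mul_le_mul_of_nonneg_right ?_ hr
    linarith
  rw [integral_neg, key, neg_zero, integral_const_mul] at hle
  have hnn : ∀ x ∈ D, 0 ≤ cutoff ε (-v x) * x 0 ^ a := fun x hx =>
    mul_nonneg cutoff_nonneg (Real.rpow_nonneg (hpos x hx).le a)
  have h0 : ∫ x in D, cutoff ε (-v x) * x 0 ^ a = 0 :=
    le_antisymm (by nlinarith) (setIntegral_nonneg hD.measurableSet hnn)
  rw [setIntegral_eq_zero_iff_of_nonneg_ae
    ((ae_restrict_iff' hD.measurableSet).2 (Eventually.of_forall hnn))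
    (hlow.integrableOn hD hb)] at h0
  have hz := Measure.eqOn_open_of_ae_eq h0 hD hlow.1 continuousOn_const hp
  have hp1 : 0 < cutoff ε (-v p) := cutoff_pos hε (by rw [hεdef]; linarith)
  exact absurd hz (mul_pos hp1 (Real.rpow_pos_of_pos (hpos p hp) a)).ne'

variable {Ω : Set (Point k)}

lemma nonneg_coord_of_mem_closure (hpos : ∀ x ∈ Ω, 0 < x 0) {x : Point k} (hx : x ∈ closure Ω) :
    0 ≤ x 0 :=
  closure_minimal (t := {x : Point k | 0 ≤ x 0}) (fun y hy => (hpos y hy).le)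
    (isClosed_le continuous_const (by fun_prop)) hx

/-- A solution of `L_a u = -1` which vanishes on the part `S` of the boundary in `r > 0` is positive
at every point of the closure which is not in the closure of `S`, those with `r = 0` included.
Near such a point `p` it lies above a multiple of `ρ² - |x - p|²`. -/
lemma pos_of_weinsteinOp_eq (ha : 0 < a) (hΩ : IsOpen Ω) (hb : Bornology.IsBounded Ω)
    (hpos : ∀ x ∈ Ω, 0 < x 0) (hu : ContDiffOn ℝ 2 u Ω) (huc : ContinuousOn u (closure Ω))
    (hub : ∀ i, BddCont Ω (partialDeriv i u)) (hL : ∀ x ∈ Ω, weinsteinOp a u x = -1)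
    (hbdry : ∀ x ∈ frontier Ω, 0 < x 0 → u x = 0) {p : Point k} (hp : p ∈ closure Ω)
    (hpS : p ∉ closure (frontier Ω ∩ {x | 0 < x 0})) : 0 < u p := by
  have hnn : ∀ x ∈ Ω, 0 ≤ u x :=
    nonneg_of_weinsteinOp_le ha hΩ hb hpos hu huc hub ((BddCont.const (-1)).congr hL) one_pos
      (fun x hx => (hL x hx).le) fun x hx h => (hbdry x hx h).ge
  have hp0 : 0 ≤ p 0 := nonneg_coord_of_mem_closure hpos hp
  -- On a small ball `p 0 / x 0` is bounded, although `x 0` need not be bounded away from `0`.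
  obtain ⟨ρ, hρ, hball⟩ : ∃ ρ > 0, ∀ x ∈ Metric.closedBall p ρ,
      x ∉ closure (frontier Ω ∩ {x | 0 < x 0}) ∧ (0 < x 0 → p 0 ≤ 2 * x 0) := by
    have h1 : ∀ᶠ x in 𝓝 p, x ∉ closure (frontier Ω ∩ {x | 0 < x 0}) :=
      isClosed_closure.isOpen_compl.mem_nhds hpS
    have h2 : ∀ᶠ x in 𝓝 p, 0 < x 0 → p 0 ≤ 2 * x 0 := by
      rcases hp0.eq_or_lt with h | h
      · exact Eventually.of_forall fun x hx => by rw [← h]; positivity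
      · have hc : Continuous fun x : Point k => 2 * x 0 := by fun_prop
        filter_upwards [hc.continuousAt.eventually (lt_mem_nhds (show p 0 < 2 * p 0 by linarith))]
          with x hx _ using hx.le
    obtain ⟨ρ, hρ, h⟩ := Metric.nhds_basis_closedBall.eventually_iff.1 (h1.and h2)
    exact ⟨ρ, hρ, fun x hx => h hx⟩
  set N : ℝ := a + 1 + k with hN
  have hN0 : 0 < N := by positivity
  set b : ℝ := 1 / (4 * N) with hbdef
  have hb0 : 0 < b := by positivity
  set m : Point k → ℝ := fun x => ∑ j, (x j - p j) * (x j - p j) with hm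
  have hmnorm : ∀ x, m x = dist x p ^ 2 := fun x => by
    rw [dist_eq_norm, EuclideanSpace.real_norm_sq_eq]
    simp [hm, sq]
  set D : Set (Point k) := Ω ∩ Metric.ball p ρ with hDdef
  have hD : IsOpen D := hΩ.inter Metric.isOpen_ball
  have hDb : Bornology.IsBounded D := hb.subset inter_subset_left
  have hDΩ : closure D ⊆ closure Ω := closure_mono inter_subset_left
  set v : Point k → ℝ := fun x => u x + b * (m x - ρ ^ 2) with hvdef
  have hmC : ContDiff ℝ 2 m := by rw [hm]; fun_prop
  have hv : ContDiffOn ℝ 2 v D := (hu.mono inter_subset_left).add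
    (contDiff_const.mul (hmC.sub contDiff_const)).contDiffOn
  have hvc : ContinuousOn v (closure D) := (huc.mono hDΩ).add
    (continuous_const.mul (hmC.continuous.sub continuous_const)).continuousOn
  have hmd : ∀ i x, partialDeriv i m x = 2 * (x i - p i) := fun i x => by
    have h1 : ∀ j, DifferentiableAt ℝ (fun z : Point k => z j - p j) x := fun j => by fun_prop
    rw [hm, partialDeriv_sum fun j _ => (h1 j).fun_mul (h1 j)]
    have h2 : ∀ j, partialDeriv i (fun z : Point k => (z j - p j) * (z j - p j)) x
        = if j = i then 2 * (x j - p j) else 0 := fun j => by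
      rw [partialDeriv_mul (h1 j) (h1 j), partialDeriv_sub (by fun_prop) (by fun_prop),
        partialDeriv_coord, partialDeriv_const]
      split_ifs <;> ring
    simp [h2]
  have hvd : ∀ i, ∀ x ∈ D, partialDeriv i v x = partialDeriv i u x + 2 * b * (x i - p i) := by
    intro i x hx
    have hud : DifferentiableAt ℝ u x :=
      (hu.differentiableOn (by norm_num)).differentiableAt (hΩ.mem_nhds hx.1)
    have hmd' : DifferentiableAt ℝ m x := hmC.differentiable (by norm_num) x
    have hmd2 : DifferentiableAt ℝ (fun x => m x - ρ ^ 2) x := hmd'.sub_const _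
    rw [hvdef, partialDeriv_add hud (hmd2.const_mul b), partialDeriv_const_mul b hmd2,
      partialDeriv_sub hmd' (by fun_prop), hmd, partialDeriv_const]
    ring
  have hvdd : ∀ i, ∀ x ∈ D, partialDeriv i (partialDeriv i v) x
      = partialDeriv i (partialDeriv i u) x + 2 * b := by
    intro i x hx
    have h1 : partialDeriv i v =ᶠ[𝓝 x] fun z => partialDeriv i u z + 2 * b * (z i - p i) := by
      filter_upwards [hD.mem_nhds hx] with z hz using hvd i z hz
    have h2 : DifferentiableAt ℝ (partialDeriv i u) x :=
      ((contDiffOn_partialDeriv hΩ (n := 1) hu).differentiableOn (by norm_num)).differentiableAt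
        (hΩ.mem_nhds hx.1)
    have h3 : DifferentiableAt ℝ (fun z : Point k => z i - p i) x := by fun_prop
    rw [partialDeriv_congr h1, partialDeriv_add h2 (h3.const_mul _), partialDeriv_const_mul _ h3,
      partialDeriv_sub (by fun_prop) (by fun_prop), partialDeriv_coord, partialDeriv_const]
    simp
  have hLv : ∀ x ∈ D, weinsteinOp a v x = -1 / 2 - a / (2 * N) * (p 0 / x 0) := by
    intro x hx
    have h0 := hpos x hx.1
    have h1 := hL x hx.1
    rw [weinsteinOp_eq_weightedDiv, weightedDiv] at h1 ⊢
    rw [Finset.sum_congr rfl fun i _ => hvdd i x hx, Finset.sum_add_distrib, hvd 0 x hx]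
    simp only [Finset.sum_const, Finset.card_univ, Fintype.card_fin, nsmul_eq_mul]
    have h2 : a / x 0 * (partialDeriv 0 u x + 2 * b * (x 0 - p 0))
        = a / x 0 * partialDeriv 0 u x + 2 * b * (a - a * (p 0 / x 0)) := by
      field_simp
    rw [h2]
    have h3 : b * N = 1 / 4 := by rw [hbdef]; field_simp
    have h4 : a / (2 * N) = 2 * b * a := by rw [hbdef]; field_simp; norm_num
    rw [h4]
    push_cast
    linear_combination h1 + 2 * h3
  have hratio : BddCont D fun x => p 0 / x 0 := by
    refine ⟨continuousOn_const.div (by fun_prop) fun x hx => (hpos x hx.1).ne', 2, fun x hx => ?_⟩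
    have h0 := hpos x hx.1
    rw [abs_of_nonneg (by positivity), div_le_iff₀ h0]
    exact (hball x (Metric.ball_subset_closedBall hx.2)).2 h0
  have hvnn : ∀ x ∈ D, 0 ≤ v x := by
    refine nonneg_of_weinsteinOp_le ha hD hDb (fun x hx => hpos x hx.1) hv hvc (fun i => ?_)
      (((BddCont.const (-1 / 2)).sub ((BddCont.const (a / (2 * N))).mul hratio)).congr hLv)
      one_half_pos (fun x hx => ?_) fun x hx hx0 => ?_
    · have h1 : BddCont D (partialDeriv i u) := ⟨(hub i).1.mono inter_subset_left,
        (hub i).2.imp fun _ hC x hx => hC x hx.1⟩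
      exact (h1.add ((BddCont.const (2 * b)).mul
        ((BddCont.coord hDb i).sub (BddCont.const (p i))))).congr (hvd i)
    · have h0 := hpos x hx.1
      rw [hLv x hx]
      have : 0 ≤ a / (2 * N) * (p 0 / x 0) := by positivity
      linarith
    · rw [hD.frontier_eq] at hx
      have hxb : x ∈ Metric.closedBall p ρ :=
        Metric.closure_ball_subset_closedBall (closure_mono inter_subset_right hx.1)
      have hxΩ : x ∈ Ω := by
        by_contra h
        refine (hball x hxb).1 (subset_closure ⟨?_, hx0⟩)
        rw [hΩ.frontier_eq]
        exact ⟨hDΩ hx.1, h⟩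
      have hd : ρ ≤ dist x p := by
        by_contra! h
        exact hx.2 ⟨hxΩ, h⟩
      have h1 : ρ ^ 2 ≤ m x := by rw [hmnorm]; gcongr
      exact add_nonneg (hnn x hxΩ) (mul_nonneg hb0.le (sub_nonneg.2 h1))
  have hpD : p ∈ closure D := by
    rw [hDdef, inter_comm]
    exact Metric.isOpen_ball.inter_closure ⟨Metric.mem_ball_self hρ, hp⟩
  have hvp : 0 ≤ v p :=
    (closure_minimal (t := {x | x ∈ closure D ∧ 0 ≤ v x})
      (fun x hx => ⟨subset_closure hx, hvnn x hx⟩)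
      (hvc.preimage_isClosed_of_isClosed isClosed_closure isClosed_Ici) hpD).2
  have hmp : m p = 0 := by rw [hmnorm, dist_self]; norm_num
  have hlast : 0 < b * ρ ^ 2 := by positivity
  simp only [hvdef, hmp] at hvp
  linarith

end MaximumPrinciple

/-! ### The Pohozaev field -/

section Pohozaev

variable {k : ℕ} {a c : ℝ} {Ω : Set (Point k)} {u φ ψ : Point k → ℝ} {x : Point k}

/-- The product rule for the weighted divergence of `φ ∇u + ψ x`; the weighted divergence of the
position field is `a + 1 + k`. -/
lemma weightedDiv_gradient_add_position (hx : x 0 ≠ 0) (hφ : DifferentiableAt ℝ φ x)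
    (hψ : DifferentiableAt ℝ ψ x) (hu : ∀ i, DifferentiableAt ℝ (partialDeriv i u) x) :
    weightedDiv a (fun i z => φ z * partialDeriv i u z + ψ z * z i) x
      = φ x * weinsteinOp a u x + ∑ i, partialDeriv i φ x * partialDeriv i u x
        + (a + 1 + k) * ψ x + ∑ i, partialDeriv i ψ x * x i := by
  have h : ∀ i, partialDeriv i (fun z => φ z * partialDeriv i u z + ψ z * z i) x
      = (partialDeriv i φ x * partialDeriv i u x + φ x * partialDeriv i (partialDeriv i u) x)
        + (partialDeriv i ψ x * x i + ψ x) := fun i => by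
    have hc := differentiable_coord i x
    rw [partialDeriv_add (hφ.fun_mul (hu i)) (hψ.fun_mul hc), partialDeriv_mul hφ (hu i),
      partialDeriv_mul hψ hc, partialDeriv_coord, if_pos rfl, mul_one]
  rw [weinsteinOp_eq_weightedDiv]
  simp only [weightedDiv, h, Finset.sum_add_distrib, Finset.sum_const, Finset.card_univ,
    Fintype.card_fin, nsmul_eq_mul, ← Finset.mul_sum]
  field_simp
  push_cast
  ring

/-- The derivative `x · ∇u` of `u` along the position field. -/
noncomputable def radialDeriv (u : Point k → ℝ) (x : Point k) : ℝ := ∑ j, x j * partialDeriv j u x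

/-- The square `|∇u|²` of the gradient. -/
noncomputable def gradSq (u : Point k → ℝ) (x : Point k) : ℝ :=
  ∑ j, partialDeriv j u x * partialDeriv j u x

/-- The components of the Pohozaev field
`(x · ∇u - (1 - N) u) ∇u + (u - |∇u|² / 2 - c² / 2) x`, with `N = a + 1 + k`. -/
noncomputable def pohozaevField (a c : ℝ) (u : Point k → ℝ) (i : Fin (k + 1)) (x : Point k) : ℝ :=
  (radialDeriv u x - (1 - (a + 1 + k)) * u x) * partialDeriv i u x
    + (u x - gradSq u x / 2 - c ^ 2 / 2) * x i

lemma contDiffOn_radialDeriv (hΩ : IsOpen Ω) (hu : ContDiffOn ℝ 2 u Ω) :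
    ContDiffOn ℝ 1 (radialDeriv u) Ω :=
  ContDiffOn.sum fun j _ => ContDiffOn.mul (by fun_prop) (contDiffOn_partialDeriv hΩ (n := 1) hu)

lemma contDiffOn_gradSq (hΩ : IsOpen Ω) (hu : ContDiffOn ℝ 2 u Ω) :
    ContDiffOn ℝ 1 (gradSq u) Ω :=
  ContDiffOn.sum fun _ _ => (contDiffOn_partialDeriv hΩ (n := 1) hu).mul
    (contDiffOn_partialDeriv hΩ (n := 1) hu)

lemma contDiffOn_pohozaevField (hΩ : IsOpen Ω) (hu : ContDiffOn ℝ 2 u Ω) (i : Fin (k + 1)) :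
    ContDiffOn ℝ 1 (pohozaevField a c u i) Ω := by
  have hu1 : ContDiffOn ℝ 1 u Ω := hu.of_le (by norm_num)
  refine ContDiffOn.add (((contDiffOn_radialDeriv hΩ hu).sub (contDiffOn_const.mul hu1)).mul
    (contDiffOn_partialDeriv hΩ (n := 1) hu)) (ContDiffOn.mul ?_ (by fun_prop))
  exact (hu1.sub ((contDiffOn_gradSq hΩ hu).div_const 2)).sub contDiffOn_const

/-- The Pohozaev identity: the terms with second derivatives cancel because those commute. -/
lemma weightedDiv_pohozaevField (hN : a + 1 + k ≠ 0) (hΩ : IsOpen Ω) (hu : ContDiffOn ℝ 2 u Ω)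
    (hL : weinsteinOp a u x = -1) (hx : x ∈ Ω) (hx0 : x 0 ≠ 0) :
    weightedDiv a (pohozaevField a c u) x
      = (a + 1 + k) / 2 * (gradSq u x + 2 / (a + 1 + k) * u x - c ^ 2) := by
  have hnhds := hΩ.mem_nhds hx
  have hud : DifferentiableAt ℝ u x := (hu.differentiableOn (by norm_num)).differentiableAt hnhds
  have hpd : ∀ i, DifferentiableAt ℝ (partialDeriv i u) x := fun i =>
    ((contDiffOn_partialDeriv hΩ (n := 1) hu).differentiableOn (by norm_num)).differentiableAt hnhds
  have hrd : DifferentiableAt ℝ (radialDeriv u) x :=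
    ((contDiffOn_radialDeriv hΩ hu).differentiableOn (by norm_num)).differentiableAt hnhds
  have hsd : DifferentiableAt ℝ (gradSq u) x :=
    ((contDiffOn_gradSq hΩ hu).differentiableOn (by norm_num)).differentiableAt hnhds
  have hr : ∀ i, partialDeriv i (radialDeriv u) x
      = partialDeriv i u x + ∑ j, x j * partialDeriv i (partialDeriv j u) x := fun i => by
    change partialDeriv i (fun z => ∑ j, z j * partialDeriv j u z) x = _
    rw [partialDeriv_sum fun j _ => (differentiable_coord j x).fun_mul (hpd j)]
    rw [Finset.sum_congr rfl fun j _ => partialDeriv_mul (differentiable_coord j x) (hpd j)]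
    simp [partialDeriv_coord, Finset.sum_add_distrib]
  have hs : ∀ i, partialDeriv i (gradSq u) x
      = 2 * ∑ j, partialDeriv j u x * partialDeriv j (partialDeriv i u) x := fun i => by
    change partialDeriv i (fun z => ∑ j, partialDeriv j u z * partialDeriv j u z) x = _
    rw [partialDeriv_sum fun j _ => (hpd j).fun_mul (hpd j), Finset.mul_sum]
    refine Finset.sum_congr rfl fun j _ => ?_
    rw [partialDeriv_mul (hpd j) (hpd j), partialDeriv_comm hΩ hu hx]
    ring
  have hφd : DifferentiableAt ℝ (fun z => radialDeriv u z - (1 - (a + 1 + k)) * u z) x :=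
    hrd.sub (hud.const_mul _)
  have hψ1 : DifferentiableAt ℝ (fun z => 1 / 2 * gradSq u z + c ^ 2 / 2) x :=
    (hsd.const_mul _).add_const _
  have hψd : DifferentiableAt ℝ (fun z => u z - (1 / 2 * gradSq u z + c ^ 2 / 2)) x := hud.sub hψ1
  have hφ : ∀ i, partialDeriv i (fun z => radialDeriv u z - (1 - (a + 1 + k)) * u z) x
      = (a + 1 + k) * partialDeriv i u x + ∑ j, x j * partialDeriv i (partialDeriv j u) x :=
    fun i => by
      rw [partialDeriv_sub hrd (hud.const_mul _), partialDeriv_const_mul _ hud, hr]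
      ring
  have hψ : ∀ i, partialDeriv i (fun z => u z - (1 / 2 * gradSq u z + c ^ 2 / 2)) x
      = partialDeriv i u x
        - ∑ j, partialDeriv j u x * partialDeriv j (partialDeriv i u) x := fun i => by
    rw [partialDeriv_sub hud hψ1, partialDeriv_add (hsd.const_mul _) (by fun_prop),
      partialDeriv_const_mul _ hsd, hs, partialDeriv_const]
    ring
  have hfield : pohozaevField a c u = fun i z =>
      (radialDeriv u z - (1 - (a + 1 + k)) * u z) * partialDeriv i u z
        + (u z - (1 / 2 * gradSq u z + c ^ 2 / 2)) * z i := by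
    funext i z
    simp only [pohozaevField]
    ring
  rw [hfield, weightedDiv_gradient_add_position hx0 hφd hψd hpd, hL]
  have e1 : ∑ i, partialDeriv i (fun z => radialDeriv u z - (1 - (a + 1 + k)) * u z) x
      * partialDeriv i u x = (a + 1 + k) * gradSq u x
        + ∑ i, ∑ j, x j * partialDeriv i u x * partialDeriv i (partialDeriv j u) x := by
    rw [gradSq, Finset.mul_sum, ← Finset.sum_add_distrib]
    refine Finset.sum_congr rfl fun i _ => ?_
    rw [hφ, add_mul, Finset.sum_mul]
    congr 1
    · ring
    · exact Finset.sum_congr rfl fun j _ => by ring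
  have e2 : ∑ i, partialDeriv i (fun z => u z - (1 / 2 * gradSq u z + c ^ 2 / 2)) x * x i
      = radialDeriv u x
        - ∑ i, ∑ j, x j * partialDeriv i u x * partialDeriv i (partialDeriv j u) x := by
    rw [Finset.sum_comm, radialDeriv, ← Finset.sum_sub_distrib]
    refine Finset.sum_congr rfl fun i _ => ?_
    rw [hψ, sub_mul, Finset.sum_mul]
    congr 1
    · ring
    · exact Finset.sum_congr rfl fun j _ => by ring
  rw [e1, e2]
  field_simp
  ring

lemma sum_pohozaevField_mul (x : Point k) :
    ∑ i, pohozaevField a c u i x * partialDeriv i u x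
      = 1 / 2 * (radialDeriv u x * (gradSq u x - c ^ 2))
        + u x * (radialDeriv u x - (1 - (a + 1 + k)) * gradSq u x) := by
  have h : ∀ i, pohozaevField a c u i x * partialDeriv i u x
      = (radialDeriv u x - (1 - (a + 1 + k)) * u x) * (partialDeriv i u x * partialDeriv i u x)
        + (u x - gradSq u x / 2 - c ^ 2 / 2) * (x i * partialDeriv i u x) := fun i => by
    simp only [pohozaevField]; ring
  rw [Finset.sum_congr rfl fun i _ => h i, Finset.sum_add_distrib, ← Finset.mul_sum,
    ← Finset.mul_sum]
  change _ * gradSq u x + _ * radialDeriv u x = _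
  ring

lemma carreDuChamp_weinsteinOp (hΩ : IsOpen Ω) (hu : ContDiffOn ℝ 2 u Ω) (hx : x ∈ Ω) :
    carreDuChamp (weinsteinOp a) u u x = gradSq u x := by
  have hud : ∀ z ∈ Ω, DifferentiableAt ℝ u z := fun z hz =>
    (hu.differentiableOn (by norm_num)).differentiableAt (hΩ.mem_nhds hz)
  have hpd : ∀ i, DifferentiableAt ℝ (partialDeriv i u) x := fun i =>
    ((contDiffOn_partialDeriv hΩ (n := 1) hu).differentiableOn (by norm_num)).differentiableAt
      (hΩ.mem_nhds hx)
  have h1 : ∀ i, ∀ z ∈ Ω, partialDeriv i (fun z => u z * u z) z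
      = 2 * (u z * partialDeriv i u z) := fun i z hz => by
    rw [partialDeriv_mul (hud z hz) (hud z hz)]; ring
  have h2 : ∀ i, partialDeriv i (partialDeriv i fun z => u z * u z) x
      = 2 * (partialDeriv i u x * partialDeriv i u x)
        + 2 * u x * partialDeriv i (partialDeriv i u) x := fun i => by
    have : partialDeriv i (fun z => u z * u z) =ᶠ[𝓝 x] fun z => 2 * (u z * partialDeriv i u z) := by
      filter_upwards [hΩ.mem_nhds hx] with z hz using h1 i z hz
    rw [partialDeriv_congr this, partialDeriv_const_mul _ ((hud x hx).fun_mul (hpd i)),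
      partialDeriv_mul (hud x hx) (hpd i)]
    ring
  simp only [carreDuChamp, weinsteinOp_eq_weightedDiv, weightedDiv, h2, h1 0 x hx,
    Finset.sum_add_distrib, ← Finset.mul_sum, gradSq]
  ring

end Pohozaev

/-! ### Estimates near the curved boundary -/

section OverdeterminedProblem

variable {k : ℕ} {a c ε κ : ℝ} {Ω : Set (Point k)} {u : Point k → ℝ} {G : Point k → Point k}

lemma radialDeriv_eq_of_grad (hG : ∀ i, ∀ x ∈ Ω, G x i = partialDeriv i u x) {x : Point k}
    (hx : x ∈ Ω) : radialDeriv u x = ∑ j, x j * G x j :=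
  Finset.sum_congr rfl fun j _ => by rw [hG j x hx]

lemma gradSq_eq_of_grad (hG : ∀ i, ∀ x ∈ Ω, G x i = partialDeriv i u x) {x : Point k}
    (hx : x ∈ Ω) : gradSq u x = ‖G x‖ ^ 2 := by
  rw [EuclideanSpace.real_norm_sq_eq]
  exact Finset.sum_congr rfl fun j _ => by rw [hG j x hx, sq]

/-- The flux `(x · ∇u) (|∇u|² - c²)` of the Pohozaev field through the level sets `u = t` is
controlled by the flux `|∇u|²` of the gradient, with an arbitrarily small factor as `t → 0`. Where
`u` is small one is close to the closure of the part `S` of the boundary in `r > 0`, and there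
`|∇u|` is close to `c`. -/
lemma exists_flux_le (hb : Bornology.IsBounded Ω) (huc : ContinuousOn u (closure Ω))
    (hGc : ContinuousOn G (closure Ω)) (hG : ∀ i, ∀ x ∈ Ω, G x i = partialDeriv i u x)
    (hupos : ∀ x ∈ closure Ω, x ∉ closure (frontier Ω ∩ {x | 0 < x 0}) → 0 < u x)
    (hGS : ∀ x ∈ frontier Ω ∩ {x | 0 < x 0}, ‖G x‖ = c) (hκ : 0 < κ) :
    ∃ t > 0, ∀ x ∈ Ω, u x < t →
      |radialDeriv u x * (gradSq u x - c ^ 2)| ≤ κ * gradSq u x := by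
  set S : Set (Point k) := frontier Ω ∩ {x | 0 < x 0} with hS
  have hSΩ : closure S ⊆ closure Ω :=
    closure_minimal (inter_subset_left.trans frontier_subset_closure) isClosed_closure
  have hcl : ∀ x ∈ closure S, ‖G x‖ = c := fun x hx =>
    (closure_minimal (t := {x | x ∈ closure Ω ∧ ‖G x‖ ∈ ({c} : Set ℝ)})
      (fun y hy => ⟨hSΩ (subset_closure hy), hGS y hy⟩)
      (hGc.norm.preimage_isClosed_of_isClosed isClosed_closure isClosed_singleton) hx).2
  have hmin : ∀ K ⊆ closure Ω, IsClosed K → (∀ x ∈ K, x ∉ closure S) →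
      ∃ t > 0, ∀ x ∈ K, t ≤ u x := by
    intro K hK hKc hKS
    rcases K.eq_empty_or_nonempty with rfl | hne
    · exact ⟨1, one_pos, fun x hx => absurd hx (notMem_empty x)⟩
    · obtain ⟨x, hx, hxmin⟩ := (hb.isCompact_closure.of_isClosed_subset hKc hK).exists_isMinOn hne
        (huc.mono hK)
      exact ⟨u x, hupos x (hK hx) (hKS x hx), fun y hy => hxmin hy⟩
  set E : Point k → ℝ := fun x => ∑ j, x j * G x j with hE
  have hEc : ContinuousOn E (closure Ω) := by
    refine continuousOn_finsetSum _ fun j _ => ContinuousOn.mul (by fun_prop) ?_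
    exact (by fun_prop : Continuous fun z : Point k => z j).comp_continuousOn hGc
  rcases eq_or_ne c 0 with rfl | hc
  · have hcl' : IsClosed {x | x ∈ closure Ω ∧ |E x| ∈ Ici κ} :=
      hEc.abs.preimage_isClosed_of_isClosed isClosed_closure isClosed_Ici
    obtain ⟨t, ht, h⟩ := hmin _ (fun x hx => hx.1) hcl' fun x hx hxS => by
      have h0 : G x = 0 := norm_eq_zero.1 (hcl x hxS)
      have : κ ≤ |E x| := hx.2
      simp only [hE, h0, PiLp.zero_apply, mul_zero, Finset.sum_const_zero, abs_zero] at this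
      linarith
    refine ⟨t, ht, fun x hx hxt => ?_⟩
    have h1 : |E x| < κ := by
      by_contra! h2
      exact absurd (h x ⟨subset_closure hx, h2⟩) (not_le.2 hxt)
    have hs : 0 ≤ gradSq u x := by rw [gradSq_eq_of_grad hG hx]; positivity
    rw [radialDeriv_eq_of_grad hG hx, abs_mul, zero_pow two_ne_zero, sub_zero, abs_of_nonneg hs]
    exact mul_le_mul_of_nonneg_right h1.le hs
  · have hcl' : IsClosed {x | x ∈ closure Ω ∧ |E x * (‖G x‖ ^ 2 - c ^ 2)| - κ * ‖G x‖ ^ 2 ∈ Ici 0} :=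
      ContinuousOn.preimage_isClosed_of_isClosed
        ((hEc.mul ((hGc.norm.pow 2).sub continuousOn_const)).abs.sub
          (continuousOn_const.mul (hGc.norm.pow 2))) isClosed_closure isClosed_Ici
    obtain ⟨t, ht, h⟩ := hmin _ (fun x hx => hx.1) hcl' fun x hx hxS => by
      have h1 : 0 ≤ |E x * (‖G x‖ ^ 2 - c ^ 2)| - κ * ‖G x‖ ^ 2 := hx.2
      rw [hcl x hxS, sub_self, mul_zero, abs_zero] at h1
      have : 0 < κ * c ^ 2 := by positivity
      linarith
    refine ⟨t, ht, fun x hx hxt => ?_⟩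
    rw [radialDeriv_eq_of_grad hG hx, gradSq_eq_of_grad hG hx]
    by_contra! h2
    exact absurd (h x ⟨subset_closure hx, sub_nonneg.2 h2.le⟩) (not_le.2 hxt)

/-- Testing `L_a u = -1` with `η_ε(u)`: the flux of `∇u` through the level sets of `u` near `0` is
bounded independently of the level. -/
lemma integral_deriv_cutoff_gradSq_le (ha : 0 < a) (hε : 0 < ε) (hΩ : IsOpen Ω)
    (hb : Bornology.IsBounded Ω) (hpos : ∀ x ∈ Ω, 0 < x 0) (hu : ContDiffOn ℝ 2 u Ω)
    (huc : ContinuousOn u (closure Ω)) (hub : ∀ i, BddCont Ω (partialDeriv i u))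
    (hL : ∀ x ∈ Ω, weinsteinOp a u x = -1) (hbdry : ∀ x ∈ frontier Ω, 0 < x 0 → u x = 0) :
    ∫ x in Ω, deriv (cutoff ε) (u x) * gradSq u x * x 0 ^ a ≤ ∫ x in Ω, x 0 ^ a := by
  have hdiv : BddCont Ω (weightedDiv a fun i => partialDeriv i u) :=
    (BddCont.const (-1)).congr fun x hx => by rw [← weinsteinOp_eq_weightedDiv, hL x hx]
  have key := integral_weightedDiv_comp ha hε hΩ hb hpos huc (hu.of_le (by norm_num)) hub
    (fun x hx h => (hbdry x hx h).le) contDiff_cutoff (fun t ht => cutoff_eq_zero hε ht)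
    (fun i => contDiffOn_partialDeriv hΩ (n := 1) hu) hub hdiv
  have hw := BddCont.weight ha hb
  have hg : BddCont Ω fun x => cutoff ε (u x) :=
    BddCont.of_continuousOn_closure hb (contDiff_cutoff.continuous.comp_continuousOn huc)
  have hg' : BddCont Ω fun x => deriv (cutoff ε) (u x) :=
    BddCont.of_continuousOn_closure hb
      ((contDiff_cutoff.continuous_deriv le_rfl).comp_continuousOn huc)
  have hs : BddCont Ω (gradSq u) := BddCont.sum fun i _ => (hub i).mul (hub i)
  have h1 : ∫ x in Ω, deriv (cutoff ε) (u x) * gradSq u x * x 0 ^ a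
      = ∫ x in Ω, cutoff ε (u x) * x 0 ^ a := by
    rw [← sub_eq_zero, ← integral_sub (((hg'.mul hs).mul hw).integrableOn hΩ hb)
      ((hg.mul hw).integrableOn hΩ hb), ← key]
    refine setIntegral_congr_fun hΩ.measurableSet fun x hx => ?_
    have : weightedDiv a (fun i => partialDeriv i u) x = -1 := by
      rw [← weinsteinOp_eq_weightedDiv, hL x hx]
    simp only [this, gradSq]
    ring
  rw [h1]
  refine setIntegral_mono_on ((hg.mul hw).integrableOn hΩ hb) (hw.integrableOn hΩ hb)
    hΩ.measurableSet fun x hx => ?_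
  exact mul_le_of_le_one_left (Real.rpow_nonneg (hpos x hx).le a) cutoff_le_one

/-! ### The integral identity -/

/-- The identity `∫ (|∇u|² + 2 u / N - c²) r^a = 0` on a domain in `r > 0`: the limit `ε → 0` of the
divergence theorem for `η_ε(u)` times the Pohozaev field. -/
theorem integral_gradSq_eq_zero (ha : 0 < a) (hΩ : IsOpen Ω)
    (hb : Bornology.IsBounded Ω) (hpos : ∀ x ∈ Ω, 0 < x 0) (hu : ContDiffOn ℝ 2 u Ω)
    (huc : ContinuousOn u (closure Ω)) (hGc : ContinuousOn G (closure Ω))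
    (hG : ∀ i, ∀ x ∈ Ω, G x i = partialDeriv i u x)
    (hL : ∀ x ∈ Ω, weinsteinOp a u x = -1) (hbdry : ∀ x ∈ frontier Ω, 0 < x 0 → u x = 0)
    (hGS : ∀ x ∈ frontier Ω, 0 < x 0 → ‖G x‖ = c) :
    IntegrableOn (fun x => (gradSq u x + 2 / (a + 1 + k) * u x - c ^ 2) * x 0 ^ a) Ω ∧
      ∫ x in Ω, (gradSq u x + 2 / (a + 1 + k) * u x - c ^ 2) * x 0 ^ a = 0 := by
  have hN : a + 1 + k ≠ 0 := by positivity
  have hub : ∀ i, BddCont Ω (partialDeriv i u) := fun i =>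
    (BddCont.of_continuousOn_closure hb
      ((by fun_prop : Continuous fun z : Point k => z i).comp_continuousOn hGc)).congr
        fun x hx => (hG i x hx).symm
  have hupos : ∀ x ∈ closure Ω, x ∉ closure (frontier Ω ∩ {x | 0 < x 0}) → 0 < u x :=
    fun x hx hxS => pos_of_weinsteinOp_eq ha hΩ hb hpos hu huc hub hL hbdry hx hxS
  have hposΩ : ∀ x ∈ Ω, 0 < u x := fun x hx => by
    refine hupos x (subset_closure hx) fun hxS => ?_
    have := closure_minimal inter_subset_left isClosed_frontier hxS
    rw [hΩ.frontier_eq] at this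
    exact this.2 hx
  have hw := BddCont.weight ha hb
  have hub0 : BddCont Ω u := BddCont.of_continuousOn_closure hb huc
  have hs : BddCont Ω (gradSq u) := BddCont.sum fun i _ => (hub i).mul (hub i)
  have hr : BddCont Ω (radialDeriv u) := BddCont.sum fun i _ => (BddCont.coord hb i).mul (hub i)
  have hP : BddCont Ω fun x => gradSq u x + 2 / (a + 1 + k) * u x - c ^ 2 :=
    (hs.add ((BddCont.const _).mul hub0)).sub (BddCont.const _)
  refine ⟨(hP.mul hw).integrableOn hΩ hb, ?_⟩
  have hZb : ∀ i, BddCont Ω (pohozaevField a c u i) := fun i =>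
    ((hr.sub ((BddCont.const _).mul hub0)).mul (hub i)).add
      ((((hub0.sub ((hs.mul (BddCont.const (1 / 2))).congr fun x _ => by ring)).sub
        (BddCont.const (c ^ 2 / 2))).mul (BddCont.coord hb i)))
  have hdiveq : ∀ x ∈ Ω, weightedDiv a (pohozaevField a c u) x
      = (a + 1 + k) / 2 * (gradSq u x + 2 / (a + 1 + k) * u x - c ^ 2) := fun x hx =>
    weightedDiv_pohozaevField hN hΩ hu (hL x hx) hx (hpos x hx).ne'
  have hdiv : BddCont Ω (weightedDiv a (pohozaevField a c u)) :=
    ((BddCont.const _).mul hP).congr hdiveq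
  set δ : ℕ → ℝ := fun n => 1 / ((n : ℝ) + 1) with hδdef
  have hδ : ∀ n, 0 < δ n := fun n => by simp only [hδdef]; positivity
  have hδlim : Tendsto (fun n => 2 * δ n) atTop (𝓝 0) := by
    have := (tendsto_one_div_add_atTop_nhds_zero_nat (𝕜 := ℝ)).const_mul 2
    rwa [mul_zero] at this
  have hg : ∀ n, BddCont Ω fun x => cutoff (δ n) (u x) := fun n =>
    BddCont.of_continuousOn_closure hb (contDiff_cutoff.continuous.comp_continuousOn huc)
  have hg' : ∀ n, BddCont Ω fun x => deriv (cutoff (δ n)) (u x) := fun n =>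
    BddCont.of_continuousOn_closure hb
      ((contDiff_cutoff.continuous_deriv le_rfl).comp_continuousOn huc)
  set A : Point k → ℝ := fun x => (a + 1 + k) / 2
    * (gradSq u x + 2 / (a + 1 + k) * u x - c ^ 2) * x 0 ^ a with hA
  set B : Point k → ℝ := fun x => (radialDeriv u x - (1 - (a + 1 + k)) * gradSq u x) * x 0 ^ a
    with hB
  set F : Point k → ℝ := fun x => radialDeriv u x * (gradSq u x - c ^ 2) with hF
  have hAb : BddCont Ω A := ((BddCont.const _).mul hP).mul hw
  have hBb : BddCont Ω B := (hr.sub ((BddCont.const _).mul hs)).mul hw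
  have hFb : BddCont Ω F := hr.mul (hs.sub (BddCont.const _))
  have hIA : ∀ n, IntegrableOn (fun x => cutoff (δ n) (u x) * A x) Ω := fun n =>
    ((hg n).mul hAb).integrableOn hΩ hb
  have hIB : ∀ n, IntegrableOn (fun x => deriv (cutoff (δ n)) (u x) * u x * B x) Ω := fun n =>
    (((hg' n).mul hub0).mul hBb).integrableOn hΩ hb
  have hIF : ∀ n, IntegrableOn (fun x => deriv (cutoff (δ n)) (u x) * F x * x 0 ^ a) Ω := fun n =>
    (((hg' n).mul hFb).mul hw).integrableOn hΩ hb
  have heq : ∀ n, ∫ x in Ω, cutoff (δ n) (u x) * A x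
      = -(∫ x in Ω, deriv (cutoff (δ n)) (u x) * u x * B x)
        - 1 / 2 * ∫ x in Ω, deriv (cutoff (δ n)) (u x) * F x * x 0 ^ a := fun n => by
    have key := integral_weightedDiv_comp ha (hδ n) hΩ hb hpos huc (hu.of_le (by norm_num)) hub
      (fun x hx h => (hbdry x hx h).le) contDiff_cutoff (fun t ht => cutoff_eq_zero (hδ n) ht)
      (contDiffOn_pohozaevField hΩ hu) hZb hdiv
    have hsplit : ∫ x in Ω, (cutoff (δ n) (u x) * weightedDiv a (pohozaevField a c u) x
        + deriv (cutoff (δ n)) (u x)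
          * ∑ i, pohozaevField a c u i x * partialDeriv i u x) * x 0 ^ a
        = ∫ x in Ω, (cutoff (δ n) (u x) * A x + (deriv (cutoff (δ n)) (u x) * u x * B x
          + 1 / 2 * (deriv (cutoff (δ n)) (u x) * F x * x 0 ^ a))) := by
      refine setIntegral_congr_fun hΩ.measurableSet fun x hx => ?_
      simp only [hdiveq x hx, sum_pohozaevField_mul, hA, hB, hF]
      ring
    have hIBF : IntegrableOn (fun x => deriv (cutoff (δ n)) (u x) * u x * B x
        + 1 / 2 * (deriv (cutoff (δ n)) (u x) * F x * x 0 ^ a)) Ω :=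
      (hIB n).add ((hIF n).const_mul _)
    rw [hsplit, integral_add (hIA n) hIBF,
      integral_add (hIB n) ((hIF n).const_mul _), integral_const_mul] at key
    linarith
  have hlimA : Tendsto (fun n => ∫ x in Ω, cutoff (δ n) (u x) * A x) atTop
      (𝓝 (∫ x in Ω, A x)) := by
    refine tendsto_integral_of_dominated_convergence (fun x => |A x|)
      (fun n => (hIA n).aestronglyMeasurable) (hAb.integrableOn hΩ hb).abs (fun n => ?_) ?_
    · refine Eventually.of_forall fun x => ?_
      rw [Real.norm_eq_abs, abs_mul]
      exact mul_le_of_le_one_left (abs_nonneg _) abs_cutoff_le_one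
    · filter_upwards [ae_restrict_mem hΩ.measurableSet] with x hx
      refine tendsto_const_nhds.congr' ?_
      filter_upwards [hδlim.eventually (gt_mem_nhds (hposΩ x hx))] with n hn
      rw [cutoff_eq_one (hδ n) hn.le, one_mul]
  have hlimB : Tendsto (fun n => ∫ x in Ω, deriv (cutoff (δ n)) (u x) * u x * B x) atTop
      (𝓝 0) := by
    obtain ⟨M, hM0, hM⟩ := exists_abs_deriv_cutoff_le
    rw [← integral_zero (Point k) ℝ (μ := volume.restrict Ω)]
    refine tendsto_integral_of_dominated_convergence (fun x => 2 * M * |B x|)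
      (fun n => (hIB n).aestronglyMeasurable) ((hBb.integrableOn hΩ hb).abs.const_mul _)
      (fun n => ?_) ?_
    · filter_upwards [ae_restrict_mem hΩ.measurableSet] with x hx
      rw [Real.norm_eq_abs, abs_mul]
      refine mul_le_mul_of_nonneg_right ?_ (abs_nonneg _)
      have hux := hposΩ x hx
      rcases lt_or_ge (2 * δ n) (u x) with h | h
      · rw [deriv_cutoff_of_gt (hδ n) h, zero_mul, abs_zero]; positivity
      · rw [abs_mul, abs_of_pos hux]
        calc |deriv (cutoff (δ n)) (u x)| * u x ≤ M / δ n * (2 * δ n) :=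
              mul_le_mul (hM _ _ (hδ n)) h hux.le (div_nonneg hM0 (hδ n).le)
          _ = 2 * M := by have := (hδ n).ne'; field_simp
    · filter_upwards [ae_restrict_mem hΩ.measurableSet] with x hx
      refine tendsto_const_nhds.congr' ?_
      filter_upwards [hδlim.eventually (gt_mem_nhds (hposΩ x hx))] with n hn
      rw [deriv_cutoff_of_gt (hδ n) hn, zero_mul, zero_mul]
  have hlimF : Tendsto (fun n => ∫ x in Ω, deriv (cutoff (δ n)) (u x) * F x * x 0 ^ a) atTop
      (𝓝 0) := by
    set W : ℝ := ∫ x in Ω, x 0 ^ a with hW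
    have hW0 : 0 ≤ W := setIntegral_nonneg hΩ.measurableSet fun x hx =>
      Real.rpow_nonneg (hpos x hx).le a
    rw [Metric.tendsto_atTop']
    intro τ hτ
    set κ : ℝ := τ / (2 * (W + 1)) with hκdef
    have hκ : 0 < κ := by positivity
    obtain ⟨t, ht, hflux⟩ := exists_flux_le hb huc hGc hG hupos (fun x hx => hGS x hx.1 hx.2) hκ
    obtain ⟨n₀, hn₀⟩ := eventually_atTop.1 (hδlim.eventually (gt_mem_nhds ht))
    refine ⟨n₀, fun n hn => ?_⟩
    rw [dist_zero_right]
    have hIs : IntegrableOn (fun x => deriv (cutoff (δ n)) (u x) * gradSq u x * x 0 ^ a) Ω :=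
      (((hg' n).mul hs).mul hw).integrableOn hΩ hb
    have h1 : ‖∫ x in Ω, deriv (cutoff (δ n)) (u x) * F x * x 0 ^ a‖
        ≤ ∫ x in Ω, κ * (deriv (cutoff (δ n)) (u x) * gradSq u x * x 0 ^ a) := by
      refine norm_integral_le_of_norm_le (hIs.const_mul κ) ?_
      filter_upwards [ae_restrict_mem hΩ.measurableSet] with x hx
      have hr0 : 0 ≤ x 0 ^ a := Real.rpow_nonneg (hpos x hx).le a
      have hd0 := deriv_cutoff_nonneg (t := u x) (hδ n)
      rw [Real.norm_eq_abs, abs_mul, abs_mul, abs_of_nonneg hr0, abs_of_nonneg hd0]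
      rcases lt_or_ge (2 * δ n) (u x) with h | h
      · rw [deriv_cutoff_of_gt (hδ n) h]; simp
      · calc deriv (cutoff (δ n)) (u x) * |F x| * x 0 ^ a
            ≤ deriv (cutoff (δ n)) (u x) * (κ * gradSq u x) * x 0 ^ a := by
              gcongr
              exact hflux x hx (h.trans_lt (hn₀ n hn.le))
          _ = _ := by ring
    rw [integral_const_mul] at h1
    have h2 := integral_deriv_cutoff_gradSq_le ha (hδ n) hΩ hb hpos hu huc hub hL hbdry
    calc _ ≤ κ * W := h1.trans (mul_le_mul_of_nonneg_left h2 hκ.le)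
      _ ≤ κ * (W + 1) := by gcongr; linarith
      _ = τ / 2 := by rw [hκdef]; field_simp
      _ < τ := half_lt_self hτ
  have hlim : Tendsto (fun n => ∫ x in Ω, cutoff (δ n) (u x) * A x) atTop (𝓝 0) := by
    have := hlimB.neg.sub (hlimF.const_mul (1 / 2))
    rw [neg_zero, mul_zero, sub_zero] at this
    exact this.congr fun n => (heq n).symm
  have hA0 : ∫ x in Ω, A x = 0 := tendsto_nhds_unique hlimA hlim
  have hA1 : ∫ x in Ω, A x = (a + 1 + k) / 2
      * ∫ x in Ω, (gradSq u x + 2 / (a + 1 + k) * u x - c ^ 2) * x 0 ^ a := by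
    rw [← integral_const_mul]
    exact integral_congr_ae (Eventually.of_forall fun x => by simp only [hA]; ring)
  rw [hA1] at hA0
  exact (mul_eq_zero.1 hA0).resolve_left (div_ne_zero hN two_ne_zero)

lemma isOpen_halfDomain {D : Set (Point k)} (hD : IsOpen D) : IsOpen (halfDomain D) :=
  hD.inter (isOpen_lt continuous_const (by fun_prop))

lemma frontier_halfDomain_subset {D : Set (Point k)} (hD : IsOpen D) {x : Point k}
    (hx : x ∈ frontier (halfDomain D)) (hx0 : 0 < x 0) : x ∈ curvedBoundary D := by
  rw [(isOpen_halfDomain hD).frontier_eq] at hx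
  refine ⟨?_, hx0⟩
  rw [hD.frontier_eq]
  exact ⟨closure_mono inter_subset_left hx.1, fun h => hx.2 ⟨h, hx0⟩⟩

end OverdeterminedProblem

end Weinstein

theorem theorem4p3 (k : ℕ) (a : ℝ) (ha : 0 < a) (c : ℝ)
    (Ωstar : Set (Weinstein.Point k))
    (hopen : IsOpen Ωstar) (hbdd : Bornology.IsBounded Ωstar) (hconn : IsConnected Ωstar)
    (hsymm : ∀ x ∈ Ωstar, Weinstein.reflect x ∈ Ωstar)
    (u : Weinstein.Point k → ℝ) (gradu : Weinstein.Point k → Weinstein.Point k)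
    (hC2 : ContDiffOn ℝ 2 u (Weinstein.halfDomain Ωstar))
    (hC1 : Weinstein.IsC1UpToBoundary (Weinstein.halfDomain Ωstar) u gradu)
    (hPDE : ∀ x ∈ Weinstein.halfDomain Ωstar, Weinstein.weinsteinOp a u x = -1)
    (hDirichlet : ∀ x ∈ Weinstein.curvedBoundary Ωstar, u x = 0)
    (hNeumann : ∀ x ∈ Weinstein.curvedBoundary Ωstar, ‖gradu x‖ = c) :
    IntegrableOn (fun x => (Weinstein.pFunction a u x - c ^ 2) * (x 0) ^ a)
        (Weinstein.halfDomain Ωstar) volume ∧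
      ∫ x in Weinstein.halfDomain Ωstar,
        (Weinstein.pFunction a u x - c ^ 2) * (x 0) ^ a = 0 := by
  have hΩ := Weinstein.isOpen_halfDomain hopen
  obtain ⟨hint, hzero⟩ := Weinstein.integral_gradSq_eq_zero (c := c) ha hΩ
    (hbdd.subset Set.inter_subset_left) (fun x hx => hx.2) hC2 hC1.continuousOn
    hC1.continuousOn_grad (fun i x hx => by rw [hC1.grad_eq x hx, Weinstein.gradient_apply]) hPDE
    (fun x hx h => hDirichlet x (Weinstein.frontier_halfDomain_subset hopen hx h))
    (fun x hx h => hNeumann x (Weinstein.frontier_halfDomain_subset hopen hx h))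
  have heq : Set.EqOn
      (fun x : Weinstein.Point k => (Weinstein.gradSq u x + 2 / (a + 1 + k) * u x - c ^ 2) * x 0 ^ a)
      (fun x => (Weinstein.pFunction a u x - c ^ 2) * x 0 ^ a) (Weinstein.halfDomain Ωstar) :=
    fun x hx => by simp only [Weinstein.pFunction, Weinstein.carreDuChamp_weinsteinOp hΩ hC2 hx]
  exact ⟨hint.congr_fun heq hΩ.measurableSet,
    (setIntegral_congr_fun hΩ.measurableSet heq).symm.trans hzero⟩
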